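/- Consider an access point serving two users $j=1,2$ with frame length $\tau=1$ (one slot per frame). User $j$ has channel reliability $p_j\in(0,1]$ and required timely throughput $q_j>0$, and $\frac{q_1}{p_1}+\frac{q_2}{p_2}=1$. In every frame $t=0,1,2,\dots$ each user has one new packet, which expires at the end of the frame, and exactly one user is attempted; the choice is made from the information available at the beginning of the frame and, conditionally on that information, the packet of the attempted user $j$ is delivered with probability $p_j$. Let $$d_j(t)=t\,q_j-\#\{\text{packets delivered to user } j \text{ in the frames } 0,\dots,t-1\}$$ be the debt of user $j$. Under the MWDF policy, which in every frame $t$ attempts a user with the largest weighted debt $d_j(t)/p_j$ (ties being broken arbitrarily), almost surely, for both $j=1,2$, $$\limsup_{t\to\infty}\frac{d_j(t)}{\varphi(t)}\le p_j\,\frac{\sqrt{c_1}+\sqrt{c_2}}{2},$$ where $\varphi(t)=\sqrt{2t\log\log t}$ and $c_j=\frac{q_j(1-p_j)}{p_j^2}$. -/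

import Mathlib

open MeasureTheory ProbabilityTheory Filter

noncomputable section

namespace RealTimeScheduling

/-- The normalization `φ(t) = √(2 t log log t)`. -/
def phi (t : ℕ) : ℝ := Real.sqrt (2 * t * Real.log (Real.log t))

/-- The constant `c_j = q_j (1 - p_j) / p_j ^ 2`. -/
def c (p q : Fin 2 → ℝ) (j : Fin 2) : ℝ := q j * (1 - p j) / p j ^ 2

open Classical in
/-- The number of packets delivered to user `j` in the frames `0, …, t - 1`, where `served s` is
the user whose packet is transmitted in frame `s` and `success s` is the event that this
transmission succeeds. -/
def deliveries {Ω : Type*} (served : ℕ → Ω → Fin 2) (success : ℕ → Set Ω)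
    (j : Fin 2) (t : ℕ) (ω : Ω) : ℕ :=
  ((Finset.range t).filter fun s => served s ω = j ∧ ω ∈ success s).card

/-- The debt `d_j(t) = t q_j - (number of packets delivered to user j in frames 0, …, t - 1)`. -/
def debt {Ω : Type*} (q : Fin 2 → ℝ) (served : ℕ → Ω → Fin 2) (success : ℕ → Set Ω)
    (j : Fin 2) (t : ℕ) (ω : Ω) : ℝ :=
  t * q j - deliveries served success j t ω

/-- The two-user system with frame length one slot: in every frame `t` exactly one user is
attempted, the choice is made from the information `ℱ t` available at the beginning of the frame
(which may include auxiliary randomization), and given that information the transmission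
succeeds with the channel reliability of the attempted user. The outcome is known at the
beginning of the next frame. -/
structure IsSystem {Ω : Type*} [mΩ : MeasurableSpace Ω] (μ : Measure Ω) (ℱ : Filtration ℕ mΩ)
    (p : Fin 2 → ℝ) (served : ℕ → Ω → Fin 2) (success : ℕ → Set Ω) : Prop where
  measurable_served : ∀ t, Measurable[ℱ t] (served t)
  measurableSet_success : ∀ t, MeasurableSet[ℱ (t + 1)] (success t)
  prob_success : ∀ t, μ⟦success t | ℱ t⟧ =ᵐ[μ] fun ω => p (served t ω)

/-- The MWDF policy: in every frame a user with the largest weighted debt `d_j(t) / p_j` is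
served. Ties are broken arbitrarily. -/
def IsMWDF {Ω : Type*} (p q : Fin 2 → ℝ) (served : ℕ → Ω → Fin 2) (success : ℕ → Set Ω) : Prop :=
  ∀ t ω k, debt q served success k t ω / p k ≤
    debt q served success (served t ω) t ω / p (served t ω)

end RealTimeScheduling

end

namespace RealTimeScheduling

/-! Write `W` and `G` for the sum and the difference of the two weighted debts `d_j / p_j`, so that
`d_j = p_j (W ± G) / 2`. Since `q 0 / p 0 + q 1 / p 1 = 1`, `W` is a martingale under every policy.
MWDF pushes `G` towards zero, so `G` is of order `log t`, negligible against `φ`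
(`IsSystem.ae_eventually_debt_gap_le`). Everything thus rests on the iterated logarithm for `W`.

An attempt for user `j` adds `(1 - p_j) / p_j` to the quadratic variation of `W`. Because the debts
are `o(t)`, user `j` gets at most a share `q_j / p_j + o(1)` of the frames
(`IsSystem.ae_eventually_attempts_le`), so the variation grows at rate at most `c_0 + c_1`. The
upper half of the law of the iterated logarithm (`IsSystem.ae_eventually_walk_le_phi`) gives `limsup
W / φ ≤ √(c_0 + c_1) ≤ √c_0 + √c_1`.

Debts, attempt counts and quadratic variations are all instances of `walk`; those with `b = 0` are
predictable. -/

/-- The additive functional whose increment in frame `s` is `a j` if the transmission to the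
attempted user `j` fails and `a j + b j` if it succeeds. -/
noncomputable def walk {Ω : Type*} (served : ℕ → Ω → Fin 2) (success : ℕ → Set Ω)
    (a b : Fin 2 → ℝ) (t : ℕ) (ω : Ω) : ℝ :=
  ∑ s ∈ Finset.range t,
    (a (served s ω) + b (served s ω) * (success s).indicator (fun _ => (1 : ℝ)) ω)

section Pathwise

variable {Ω : Type*} {served : ℕ → Ω → Fin 2} {success : ℕ → Set Ω}

theorem walk_zero (a b : Fin 2 → ℝ) (ω : Ω) : walk served success a b 0 ω = 0 := by
  simp [walk]

theorem walk_succ (a b : Fin 2 → ℝ) (t : ℕ) (ω : Ω) :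
    walk served success a b (t + 1) ω = walk served success a b t ω +
      (a (served t ω) + b (served t ω) * (success t).indicator (fun _ => (1 : ℝ)) ω) := by
  simp [walk, Finset.sum_range_succ]

theorem exists_abs_walk_le (a b : Fin 2 → ℝ) (t : ℕ) :
    ∃ C, ∀ ω, |walk served success a b t ω| ≤ C := by
  refine ⟨∑ s ∈ Finset.range t, ∑ j, (|a j| + |b j|), fun ω => ?_⟩
  refine (Finset.abs_sum_le_sum_abs _ _).trans (Finset.sum_le_sum fun s _ => ?_)
  have h1 : |a (served s ω) + b (served s ω) * (success s).indicator (fun _ => (1 : ℝ)) ω|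
      ≤ |a (served s ω)| + |b (served s ω)| := by
    by_cases h : ω ∈ success s
    · simpa [h] using abs_add_le _ _
    · simp [h]
  exact h1.trans (Finset.single_le_sum (f := fun j => |a j| + |b j|)
    (fun j _ => by positivity) (Finset.mem_univ _))

end Pathwise

/-! ### One-step conditioning and the exponential maximal inequality. -/

section Walk

variable {Ω : Type*} [mΩ : MeasurableSpace Ω] {μ : Measure Ω} {ℱ : Filtration ℕ mΩ}
  {p : Fin 2 → ℝ} {served : ℕ → Ω → Fin 2} {success : ℕ → Set Ω}

theorem IsSystem.measurable_walk (hsys : IsSystem μ ℱ p served success) (a b : Fin 2 → ℝ)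
    (t : ℕ) : Measurable[ℱ t] (walk served success a b t) := by
  unfold walk
  refine Finset.measurable_sum _ fun s hs => ?_
  have hst : s < t := Finset.mem_range.1 hs
  have h1 : Measurable[ℱ t] (served s) :=
    (hsys.measurable_served s).mono (ℱ.mono hst.le) le_rfl
  have h2 : MeasurableSet[ℱ t] (success s) := ℱ.mono hst _ (hsys.measurableSet_success s)
  exact ((measurable_of_finite a).comp h1).add
    (((measurable_of_finite b).comp h1).mul (measurable_const.indicator h2))

theorem integrable_continuous_comp [IsFiniteMeasure μ] {f : ℝ → ℝ} (hf : Continuous f)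
    {u : Ω → ℝ} (hu : Measurable u) {C : ℝ} (hC : ∀ ω, |u ω| ≤ C) :
    Integrable (fun ω => f (u ω)) μ := by
  obtain ⟨D, hD⟩ := (isCompact_Icc (a := -C) (b := C)).exists_bound_of_continuousOn hf.continuousOn
  exact Integrable.of_bound (hf.measurable.comp hu).aestronglyMeasurable D
    (ae_of_all _ fun ω => hD _ (abs_le.1 (hC ω)))

theorem IsSystem.integrable_comp_walk [IsFiniteMeasure μ] (hsys : IsSystem μ ℱ p served success)
    (a b : Fin 2 → ℝ) (t : ℕ) {f : ℝ → ℝ} (hf : Continuous f) :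
    Integrable (fun ω => f (walk served success a b t ω)) μ := by
  obtain ⟨C, hC⟩ := exists_abs_walk_le (served := served) (success := success) a b t
  exact integrable_continuous_comp hf ((hsys.measurable_walk a b t).mono (ℱ.le t) le_rfl) hC

/-- `Z` is known at time `t`, so it pulls out of the conditional expectation given `ℱ t`. -/
theorem IsSystem.integral_mul_success [IsProbabilityMeasure μ]
    (hsys : IsSystem μ ℱ p served success)
    (t : ℕ) {Z : Ω → ℝ} (hZ : Measurable[ℱ t] Z) (hint : Integrable Z μ) :
    ∫ ω, Z ω * (success t).indicator (fun _ => (1 : ℝ)) ω ∂μ = ∫ ω, Z ω * p (served t ω) ∂μ := by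
  have hms : MeasurableSet (success t) := ℱ.le _ _ (hsys.measurableSet_success t)
  have hg : Integrable ((success t).indicator (fun _ => (1 : ℝ))) μ :=
    (integrable_const 1).indicator hms
  have hZg : Integrable (Z * (success t).indicator (fun _ => (1 : ℝ))) μ := by
    refine (hint.indicator hms).congr (ae_of_all _ fun ω => ?_)
    by_cases h : ω ∈ success t <;> simp [h]
  have h := condExp_mul_of_stronglyMeasurable_left hZ.stronglyMeasurable hZg hg
  calc _ = ∫ ω, (μ[Z * (success t).indicator (fun _ => (1 : ℝ)) | ℱ t]) ω ∂μ :=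
        (integral_condExp (ℱ.le t)).symm
    _ = _ := by
        refine integral_congr_ae (h.trans ?_)
        filter_upwards [hsys.prob_success t] with ω hω
        simp [hω]

/-- One-step drift bound: if the conditional mean of `f (walk (t + 1))` is at most `g` on an event
known at time `t`, then so are the integrals over that event. -/
theorem IsSystem.setIntegral_walk_succ_le [IsProbabilityMeasure μ]
    (hsys : IsSystem μ ℱ p served success)
    (a b : Fin 2 → ℝ) (t : ℕ) {f : ℝ → ℝ} (hf : Continuous f) {A : Set Ω}
    (hA : MeasurableSet[ℱ t] A) {g : Ω → ℝ} (hg : Integrable g μ)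
    (h : ∀ ω ∈ A, p (served t ω) *
        f (walk served success a b t ω + (a (served t ω) + b (served t ω))) +
      (1 - p (served t ω)) * f (walk served success a b t ω + a (served t ω)) ≤ g ω) :
    ∫ ω in A, f (walk served success a b (t + 1) ω) ∂μ ≤ ∫ ω in A, g ω ∂μ := by
  have hm := hsys.measurable_walk a b t
  obtain ⟨C, hC⟩ := exists_abs_walk_le (served := served) (success := success) a b t
  have hA' : MeasurableSet A := ℱ.le t _ hA
  have key : ∀ e : Fin 2 → ℝ,
      Measurable[ℱ t] (fun ω => f (walk served success a b t ω + e (served t ω))) ∧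
      Integrable (fun ω => f (walk served success a b t ω + e (served t ω))) μ := by
    intro e
    have h1 : Measurable[ℱ t] (fun ω => walk served success a b t ω + e (served t ω)) :=
      hm.add ((measurable_of_finite e).comp (hsys.measurable_served t))
    refine ⟨hf.measurable.comp h1, integrable_continuous_comp hf (h1.mono (ℱ.le t) le_rfl)
      (C := C + ∑ j, |e j|) fun ω => (abs_add_le _ _).trans (add_le_add (hC ω) ?_)⟩
    exact Finset.single_le_sum (f := fun j => |e j|) (fun j _ => abs_nonneg _) (Finset.mem_univ _)
  obtain ⟨m0, i0⟩ := key a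
  obtain ⟨m1, i1⟩ := key (fun j => a j + b j)
  set F0 := fun ω => f (walk served success a b t ω + a (served t ω))
  set F1 := fun ω => f (walk served success a b t ω + (a (served t ω) + b (served t ω)))
  have hZ : Measurable[ℱ t] (A.indicator (F1 - F0)) := (m1.sub m0).indicator hA
  have hZi : Integrable (A.indicator (F1 - F0)) μ := (i1.sub i0).indicator hA'
  have hZp : Integrable (fun ω => A.indicator (F1 - F0) ω * p (served t ω)) μ := by
    refine hZi.mul_bdd (c := ∑ j, |p j|)
      (((measurable_of_finite p).comp
        ((hsys.measurable_served t).mono (ℱ.le t) le_rfl)).aestronglyMeasurable)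
      (ae_of_all _ fun ω => ?_)
    exact Finset.single_le_sum (f := fun j => |p j|) (fun j _ => abs_nonneg _) (Finset.mem_univ _)
  have hms : MeasurableSet (success t) := ℱ.le _ _ (hsys.measurableSet_success t)
  have hZs : Integrable (fun ω => A.indicator (F1 - F0) ω *
      (success t).indicator (fun _ => (1 : ℝ)) ω) μ := by
    refine (hZi.indicator hms).congr (ae_of_all _ fun ω => ?_)
    by_cases h : ω ∈ success t <;> simp [h]
  rw [← integral_indicator hA', ← integral_indicator hA']
  -- `F0` and `F1`, the values after failure and success, are both known at time `t`; only the
  -- success indicator is new.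
  have e1 : ∀ ω, A.indicator (fun ω => f (walk served success a b (t + 1) ω)) ω =
      A.indicator F0 ω + A.indicator (F1 - F0) ω *
        (success t).indicator (fun _ => (1 : ℝ)) ω := by
    intro ω
    by_cases h : ω ∈ success t <;> by_cases h' : ω ∈ A <;>
      simp [h, h', walk_succ, F0, F1]
  simp_rw [e1]
  rw [integral_add (i0.indicator hA') hZs, hsys.integral_mul_success t hZ hZi,
    ← integral_add (i0.indicator hA') hZp]
  refine integral_mono ((i0.indicator hA').add hZp) (hg.indicator hA') fun ω => ?_
  by_cases h' : ω ∈ A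
  · have := h ω h'
    simp only [h', Set.indicator_of_mem, Pi.sub_apply, F0, F1]
    linarith
  · simp [h']

/-- Maximal inequality for an exponential supermartingale. -/
theorem IsSystem.measure_exists_le_walk_le [IsProbabilityMeasure μ]
    (hsys : IsSystem μ ℱ p served success) {a b : Fin 2 → ℝ}
    (hab : ∀ j, p j * Real.exp (a j + b j) + (1 - p j) * Real.exp (a j) ≤ 1) (x : ℝ) :
    μ {ω | ∃ n, x ≤ walk served success a b n ω} ≤ ENNReal.ofReal (Real.exp (-x)) := by
  set U := walk served success a b
  -- No crossing strictly before `n`: thus `A (n + 1)` is already known at time `n`, as the drift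
  -- bound requires.
  let A : ℕ → Set Ω := fun n => {ω | ∀ m < n, U m ω < x}
  have hAm : ∀ n t, n ≤ t + 1 → MeasurableSet[ℱ t] (A n) := by
    intro n t hnt
    have : A n = ⋂ m ∈ Finset.range n, {ω | U m ω < x} := by ext; simp [A]
    rw [this]
    refine Finset.measurableSet_biInter _ fun m hm => ?_
    have hm' : m < n := Finset.mem_range.1 hm
    exact measurableSet_lt ((hsys.measurable_walk a b m).mono (ℱ.mono (by omega)) le_rfl)
      measurable_const
  have hAm' : ∀ n, MeasurableSet (A n) := fun n => ℱ.le n _ (hAm n n (by omega))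
  have hint : ∀ n, Integrable (fun ω => Real.exp (U n ω)) μ :=
    fun n => hsys.integrable_comp_walk a b n Real.continuous_exp
  have hsub : ∀ n, A (n + 1) ⊆ A n := fun n ω h m hm => h m (by omega)
  -- Paths leaving `A n` at this step have `U n ≥ x`, so their exponential mass pays for the growth
  -- of the second term.
  have main : ∀ n, ∫ ω in A n, Real.exp (U n ω) ∂μ + Real.exp x * μ.real (A n)ᶜ ≤ 1 := by
    intro n
    induction n with
    | zero => simp [A, U, walk_zero]
    | succ n ih =>
      have h1 : ∫ ω in A (n + 1), Real.exp (U (n + 1) ω) ∂μ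
          ≤ ∫ ω in A (n + 1), Real.exp (U n ω) ∂μ := by
        refine hsys.setIntegral_walk_succ_le a b n Real.continuous_exp
          (hAm (n + 1) n le_rfl) (hint n) fun ω _ => ?_
        have := mul_le_mul_of_nonneg_left (hab (served n ω)) (Real.exp_pos (U n ω)).le
        rw [Real.exp_add, Real.exp_add _ (a _)]
        linarith
      have h2 : ∫ ω in A n, Real.exp (U n ω) ∂μ = ∫ ω in A (n + 1), Real.exp (U n ω) ∂μ +
          ∫ ω in A n \ A (n + 1), Real.exp (U n ω) ∂μ := by
        rw [← setIntegral_union Set.disjoint_sdiff_right ((hAm' n).diff (hAm' (n + 1)))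
          (hint n).integrableOn (hint n).integrableOn, Set.union_sdiff_cancel (hsub n)]
      have h3 : Real.exp x * μ.real (A n \ A (n + 1))
          ≤ ∫ ω in A n \ A (n + 1), Real.exp (U n ω) ∂μ := by
        have := setIntegral_mono_on (μ := μ) (s := A n \ A (n + 1)) (f := fun _ => Real.exp x)
          (integrable_const _).integrableOn (hint n).integrableOn
          ((hAm' n).diff (hAm' (n + 1))) (fun ω hω => by
            apply Real.exp_le_exp.2
            by_contra hlt
            refine hω.2 fun m hm => ?_
            rcases Nat.lt_succ_iff_lt_or_eq.1 hm with h | rfl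
            · exact hω.1 m h
            · exact not_le.1 hlt)
        simpa [mul_comm] using this
      have h4 : μ.real (A (n + 1))ᶜ = μ.real (A n)ᶜ + μ.real (A n \ A (n + 1)) := by
        rw [← measureReal_union (disjoint_compl_left.mono_right Set.sdiff_subset)
          ((hAm' n).diff (hAm' (n + 1)))]
        congr 1
        ext ω
        have := @hsub n ω
        simp only [Set.mem_compl_iff, Set.mem_union, Set.mem_sdiff]
        tauto
      rw [h4]
      linarith
  have hunion : {ω | ∃ n, x ≤ U n ω} = ⋃ n, (A n)ᶜ := by
    ext ω
    simp only [Set.mem_ofPred_eq, Set.mem_iUnion, Set.mem_compl_iff, A, not_forall, not_lt]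
    exact ⟨fun ⟨n, h⟩ => ⟨n + 1, n, by omega, h⟩, fun ⟨_, n, _, h⟩ => ⟨n, h⟩⟩
  have hmono : Monotone fun n => (A n)ᶜ :=
    monotone_nat_of_le_succ fun n => Set.compl_subset_compl.2 (hsub n)
  rw [hunion, hmono.measure_iUnion]
  refine iSup_le fun n => ?_
  rw [← ofReal_measureReal]
  refine ENNReal.ofReal_le_ofReal ?_
  have h0 : 0 ≤ ∫ ω in A n, Real.exp (U n ω) ∂μ := integral_nonneg fun ω => (Real.exp_pos _).le
  have := main n
  rw [Real.exp_neg, ← one_div, le_div_iff₀ (Real.exp_pos x)]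
  linarith

end Walk

/-! ### Exponential estimates and Borel–Cantelli on a geometric time scale. -/

/-- The cubic Taylor remainder is at most `(2/9) |x| ^ 3`, which `η x ^ 2 / 2` absorbs. -/
theorem exp_le_quadratic {x η : ℝ} (hx : |x| ≤ η) (hη : η ≤ 1) :
    Real.exp x ≤ 1 + x + (1 + η) * x ^ 2 / 2 := by
  have h := Real.exp_bound (hx.trans hη) (n := 3) (by norm_num)
  have h1 := (abs_le.1 h).2
  norm_num [Finset.sum_range_succ, Nat.factorial] at h1
  have h2 : |x| ^ 3 = |x| * x ^ 2 := by rw [pow_succ', sq_abs]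
  have h3 : |x| * x ^ 2 ≤ η * x ^ 2 := mul_le_mul_of_nonneg_right hx (sq_nonneg x)
  have h4 : 0 ≤ |x| * x ^ 2 := by positivity
  rw [h2] at h1
  linarith

/-- A centred two-point variable with small range has an almost Gaussian moment generating
function. -/
theorem two_point_exp_le_one {p a b l η : ℝ} (hp0 : 0 ≤ p) (hp1 : p ≤ 1) (hab : a + b * p = 0)
    (hη : η ≤ 1) (h0 : |l * a| ≤ η) (h1 : |l * (a + b)| ≤ η) :
    p * Real.exp ((l * a - l ^ 2 * (1 + η) / 2 * (p * (1 - p) * b ^ 2)) + l * b) +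
      (1 - p) * Real.exp (l * a - l ^ 2 * (1 + η) / 2 * (p * (1 - p) * b ^ 2)) ≤ 1 := by
  have e0 := exp_le_quadratic h0 hη
  have e1 := exp_le_quadratic h1 hη
  set w := l ^ 2 * (1 + η) / 2 * (p * (1 - p) * b ^ 2) with hw
  have ha : a = -(b * p) := by linarith
  have h2 : p * Real.exp (l * (a + b)) + (1 - p) * Real.exp (l * a) ≤ Real.exp w := by
    have h3 := Real.add_one_le_exp w
    have h4 := mul_le_mul_of_nonneg_left e1 hp0
    have h5 := mul_le_mul_of_nonneg_left e0 (sub_nonneg.2 hp1)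
    -- Centring kills the linear terms, and the second moment is `p (1 - p) b ^ 2`.
    have h6 : p * (1 + l * (a + b) + (1 + η) * (l * (a + b)) ^ 2 / 2) +
        (1 - p) * (1 + l * a + (1 + η) * (l * a) ^ 2 / 2) = w + 1 := by
      rw [hw, ha]; ring
    linarith
  have h3 : l * a - w + l * b = l * (a + b) - w := by ring
  rw [h3, Real.exp_sub, Real.exp_sub, ← mul_div_assoc, ← mul_div_assoc, ← add_div,
    div_le_one (Real.exp_pos _)]
  exact h2

theorem ae_eventually_notMem_of_le {Ω : Type*} [MeasurableSpace Ω] {μ : Measure Ω}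
    {s : ℕ → Set Ω} {f : ℕ → ℝ} (hf : Summable f)
    (h : ∀ᶠ k in atTop, μ (s k) ≤ ENNReal.ofReal (f k)) :
    ∀ᵐ ω ∂μ, ∀ᶠ k in atTop, ω ∉ s k := by
  obtain ⟨N, hN⟩ := eventually_atTop.1 h
  have hsum : ∑' k, μ (s (k + N)) ≠ ⊤ := by
    refine ne_top_of_le_ne_top ?_ (ENNReal.tsum_le_tsum fun k => hN (k + N) (by omega))
    exact ((summable_nat_add_iff N).2 hf).tsum_ofReal_ne_top
  filter_upwards [ae_eventually_notMem hsum] with ω hω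
  obtain ⟨M, hM⟩ := eventually_atTop.1 hω
  refine eventually_atTop.2 ⟨M + N, fun k hk => ?_⟩
  have := hM (k - N) (by omega)
  rwa [Nat.sub_add_cancel (by omega)] at this

/-- `r ^ m ≤ n` gives `m ≤ log n / log r`, and `(log n) ^ η` eventually exceeds the constant `1 /
log r + 1`. -/
theorem eventually_log_le_loglog {r η : ℝ} (hr : 1 < r) (hη : 0 < η) :
    ∀ᶠ n : ℕ in atTop, ∀ m : ℕ, r ^ m ≤ n →
      Real.log ((m + 1 : ℕ) : ℝ) ≤ (1 + η) * Real.log (Real.log n) := by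
  have hlr : 0 < Real.log r := Real.log_pos hr
  have hlog : Tendsto (fun n : ℕ => Real.log n) atTop atTop :=
    Real.tendsto_log_atTop.comp tendsto_natCast_atTop_atTop
  have h1 := hlog.eventually ((tendsto_rpow_atTop hη).eventually_ge_atTop (1 / Real.log r + 1))
  filter_upwards [h1, hlog.eventually_ge_atTop 1, eventually_gt_atTop 0] with n hn hn1 hn0 m hm
  have hn0' : (0 : ℝ) < n := by exact_mod_cast hn0
  have h2 : m * Real.log r ≤ Real.log n := by
    rw [← Real.log_pow]; exact Real.log_le_log (by positivity) hm
  have h3 : ((m + 1 : ℕ) : ℝ) ≤ Real.log n ^ (1 + η) := by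
    rw [Real.rpow_add (by linarith), Real.rpow_one]
    have h4 : (m : ℝ) ≤ Real.log n / Real.log r := by rwa [le_div_iff₀ hlr]
    have h5 := mul_le_mul_of_nonneg_left hn (zero_le_one.trans hn1)
    push_cast
    have h6 : Real.log n * (1 / Real.log r + 1) = Real.log n / Real.log r + Real.log n := by ring
    linarith
  rw [← Real.log_rpow (by linarith)]
  exact Real.log_le_log (by positivity) h3

/-- The four factors are the losses in the iterated logarithm bound: two from squaring the bound on
the walk, one from `log k` against `log log n`, one from the block ratio. -/
theorem exists_pow_four_mul_le {B B' : ℝ} (hBB : B < B') :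
    ∃ η : ℝ, 0 < η ∧ η ≤ 1 ∧ (1 + η) ^ 4 * B ≤ B' := by
  have hc : Tendsto (fun η : ℝ => (1 + η) ^ 4 * B) (nhdsWithin 0 (Set.Ioi 0)) (nhds B) := by
    have : ContinuousAt (fun η : ℝ => (1 + η) ^ 4 * B) 0 := by fun_prop
    have h := this.tendsto
    norm_num at h
    exact h.mono_left nhdsWithin_le_nhds
  have h1 := hc.eventually (eventually_le_nhds hBB)
  have h2 : ∀ᶠ η : ℝ in nhdsWithin 0 (Set.Ioi 0), η ≤ 1 :=
    (eventually_le_nhds zero_lt_one).filter_mono nhdsWithin_le_nhds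
  have h3 : ∀ᶠ η : ℝ in nhdsWithin 0 (Set.Ioi 0), 0 < η := eventually_mem_nhdsWithin
  obtain ⟨η, a, b, c⟩ := (h3.and (h2.and h1)).exists
  exact ⟨η, a, b, c⟩

theorem tendsto_log_div_pow {r : ℝ} (hr : 1 < r) :
    Tendsto (fun k : ℕ => Real.log k / r ^ k) atTop (nhds 0) := by
  have h := tendsto_pow_const_div_const_pow_of_one_lt 1 hr
  refine squeeze_zero (fun k => ?_) (fun k => ?_) h
  · exact div_nonneg (Real.log_natCast_nonneg k) (by positivity)
  · rw [pow_one]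
    exact div_le_div_of_nonneg_right (Real.log_le_self (Nat.cast_nonneg k)) (by positivity)

theorem walk_linear_combination {Ω : Type*} {served : ℕ → Ω → Fin 2} {success : ℕ → Set Ω}
    (l m : ℝ) (a b a' b' : Fin 2 → ℝ) (t : ℕ) (ω : Ω) :
    walk served success (fun j => l * a j + m * a' j) (fun j => l * b j + m * b' j) t ω =
      l * walk served success a b t ω + m * walk served success a' b' t ω := by
  simp only [walk, Finset.mul_sum, ← Finset.sum_add_distrib]
  exact Finset.sum_congr rfl fun s _ => by ring

theorem walk_sub_smul {Ω : Type*} {served : ℕ → Ω → Fin 2} {success : ℕ → Set Ω}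
    (a b v : Fin 2 → ℝ) (l w : ℝ) (t : ℕ) (ω : Ω) :
    walk served success (fun j => l * a j - w * v j) (fun j => l * b j) t ω =
      l * walk served success a b t ω - w * walk served success v 0 t ω := by
  simpa [sub_eq_add_neg] using walk_linear_combination l (-w) a b v 0 t ω

/-! ### The upper half of the law of the iterated logarithm. -/

section Walk

variable {Ω : Type*} [mΩ : MeasurableSpace Ω] {μ : Measure Ω} {ℱ : Filtration ℕ mΩ}
  {p : Fin 2 → ℝ} {served : ℕ → Ω → Fin 2} {success : ℕ → Set Ω}

/-- The upper half of the law of the iterated logarithm for a centred walk whose predictable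
quadratic variation is eventually at most `B n`. -/
theorem IsSystem.ae_eventually_walk_le_phi [IsProbabilityMeasure μ]
    (hsys : IsSystem μ ℱ p served success) (hp : ∀ j, 0 < p j ∧ p j ≤ 1) {a b : Fin 2 → ℝ}
    (hab : ∀ j, a j + b j * p j = 0) {B B' : ℝ} (hB : 0 < B) (hBB : B < B')
    (hV : ∀ᵐ ω ∂μ, ∀ᶠ n : ℕ in atTop,
      walk served success (fun j => p j * (1 - p j) * b j ^ 2) 0 n ω ≤ B * n) :
    ∀ᵐ ω ∂μ, ∀ᶠ n : ℕ in atTop, walk served success a b n ω ≤ Real.sqrt B' * phi n := by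
  obtain ⟨η, hη0, hη1, hη⟩ := exists_pow_four_mul_le hBB
  have hr : 1 < 1 + η := by linarith
  set v : Fin 2 → ℝ := fun j => p j * (1 - p j) * b j ^ 2 with hv
  -- The tilt for times up to `R = (1 + η) ^ k`, fixed by `l k ^ 2 * B * R / 2 = log k`. Threshold
  -- and compensator are then both at most `(1 + η) log k`, and the threshold yields the summable
  -- tail `k ^ (-(1 + η))`.
  let l : ℕ → ℝ := fun k => Real.sqrt (2 * Real.log k / (B * (1 + η) ^ k))
  let w : ℕ → ℝ := fun k => l k ^ 2 * (1 + η) / 2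
  have hl : Tendsto l atTop (nhds 0) := by
    have h := ((tendsto_log_div_pow hr).const_mul (2 / B)).sqrt
    rw [mul_zero, Real.sqrt_zero] at h
    refine h.congr fun k => ?_
    simp only [l]
    congr 1
    field_simp
  have hsmall : ∀ᶠ k in atTop, ∀ j, |l k * a j| ≤ η ∧ |l k * (a j + b j)| ≤ η := by
    have aux : ∀ x : ℝ, ∀ᶠ k in atTop, |l k * x| ≤ η := by
      intro x
      have h := (hl.mul_const x).abs
      rw [zero_mul, abs_zero] at h
      exact h.eventually (eventually_le_nhds hη0)
    exact eventually_all.2 fun j => (aux _).and (aux _)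
  have hsum : Summable fun k : ℕ => (1 : ℝ) / (k : ℝ) ^ (1 + η) :=
    Real.summable_one_div_nat_rpow.2 hr
  have hBC := ae_eventually_notMem_of_le (μ := μ)
    (s := fun k => {ω | ∃ n, (1 + η) * Real.log k ≤
      walk served success (fun j => l k * a j - w k * v j) (fun j => l k * b j) n ω}) hsum (by
    filter_upwards [hsmall, eventually_gt_atTop 0] with k hk hk0
    have hk0' : (0 : ℝ) < k := by exact_mod_cast hk0
    refine (hsys.measure_exists_le_walk_le (fun j => ?_) _).trans (le_of_eq ?_)
    · exact two_point_exp_le_one (hp j).1.le (hp j).2 (hab j) hη1 (hk j).1 (hk j).2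
    · rw [one_div, ← Real.rpow_neg hk0'.le, Real.rpow_def_of_pos hk0']
      congr 2
      ring)
  filter_upwards [hBC, hV] with ω h1 h2
  obtain ⟨N, hN⟩ := eventually_atTop.1 (h1.and (eventually_ge_atTop 2))
  have hbig : ∀ᶠ n : ℕ in atTop, (1 + η) ^ N ≤ (n : ℝ) :=
    tendsto_natCast_atTop_atTop.eventually_ge_atTop _
  filter_upwards [h2, hbig, eventually_log_le_loglog hr hη0, eventually_ge_atTop 1]
    with n hVn hNn hlogn hn1
  have hn1' : (1 : ℝ) ≤ n := by exact_mod_cast hn1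
  -- The block index is `m + 1`: the right endpoint bounds the variation, the left one costs a
  -- factor `1 + η`.
  obtain ⟨m, hm1, hm2⟩ := exists_nat_pow_near hn1' hr
  have hk : N < m + 1 := (pow_lt_pow_iff_right₀ hr).1 (hNn.trans_lt hm2)
  obtain ⟨hnot, hk2⟩ := hN (m + 1) hk.le
  have hlog := hlogn m hm1
  set k := m + 1 with hkdef
  set R := (1 + η) ^ k with hR
  have hRpos : 0 < R := by positivity
  have hRn : R ≤ (1 + η) * n := by
    rw [hR, hkdef, pow_succ, mul_comm]
    exact mul_le_mul_of_nonneg_left hm1 (by linarith)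
  have hlogk : 0 < Real.log k := Real.log_pos (by exact_mod_cast hk2)
  have hlpos : 0 < l k := Real.sqrt_pos.2 (by positivity)
  have hlsq : l k ^ 2 * (B * R) = 2 * Real.log k := by
    simp only [l]
    rw [Real.sq_sqrt (by positivity)]
    exact div_mul_cancel₀ _ (by positivity)
  have hlt : l k * walk served success a b n ω - w k * walk served success v 0 n ω <
      (1 + η) * Real.log k := by
    by_contra hge
    exact hnot ⟨n, by rw [walk_sub_smul]; exact not_lt.1 hge⟩
  have hwV : w k * walk served success v 0 n ω ≤ (1 + η) * Real.log k := by
    have h3 : walk served success v 0 n ω ≤ B * R :=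
      hVn.trans (mul_le_mul_of_nonneg_left hm2.le hB.le)
    have h4 : 0 ≤ w k := by simp only [w]; positivity
    refine (mul_le_mul_of_nonneg_left h3 h4).trans (le_of_eq ?_)
    simp only [w]
    linear_combination (1 + η) / 2 * hlsq
  have hS : walk served success a b n ω ≤ (1 + η) * (l k * (B * R)) := by
    refine le_of_mul_le_mul_left ?_ hlpos
    have : l k * ((1 + η) * (l k * (B * R))) = (1 + η) * (2 * Real.log k) := by
      rw [← hlsq]; ring
    rw [this]
    linarith
  refine hS.trans ?_
  have hB' : 0 ≤ B' := (hB.trans hBB).le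
  rw [phi, ← Real.sqrt_mul hB']
  refine Real.le_sqrt_of_sq_le ?_
  have h5 : ((1 + η) * (l k * (B * R))) ^ 2 = (1 + η) ^ 2 * (2 * Real.log k) * (B * R) := by
    rw [← hlsq]; ring
  rw [h5]
  have hLL : 0 ≤ Real.log (Real.log n) := by
    by_contra hneg
    have := mul_neg_of_pos_of_neg (by linarith : 0 < 1 + η) (not_le.1 hneg)
    linarith
  calc (1 + η) ^ 2 * (2 * Real.log k) * (B * R)
      ≤ (1 + η) ^ 2 * (2 * ((1 + η) * Real.log (Real.log n))) * (B * ((1 + η) * n)) := by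
        gcongr
    _ = ((1 + η) ^ 4 * B) * (2 * n * Real.log (Real.log n)) := by ring
    _ ≤ B' * (2 * n * Real.log (Real.log n)) := by gcongr

end Walk

/-! ### Exponential Lyapunov function for a walk drifting towards zero. -/

/-- Steps are at most `K < x`, so the absolute value stays linear. The choice of `θ` makes the
second-order term half of the drift gain `θ δ`. -/
theorem lyapunov_step_of_pos {p a b x θ K δ : ℝ} (hp0 : 0 ≤ p) (hp1 : p ≤ 1) (hθ : 0 ≤ θ)
    (hθK : θ * K ≤ 1) (hθδ : θ * K ^ 2 = δ / 2) (ha : |a| ≤ K) (hab : |a + b| ≤ K) (hx : K < x)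
    (hd : a + b * p ≤ -δ) :
    p * Real.exp (θ * |x + (a + b)|) + (1 - p) * Real.exp (θ * |x + a|) ≤
      (1 - θ * δ / 2) * Real.exp (θ * |x|) := by
  have aux : ∀ y : ℝ, |y| ≤ K →
      Real.exp (θ * |x + y|) ≤ Real.exp (θ * |x|) * (1 + θ * y + θ * (δ / 2)) := by
    intro y hy
    have hK : 0 ≤ K := (abs_nonneg y).trans hy
    rw [abs_of_pos (by linarith : 0 < x), abs_of_nonneg (by linarith [(abs_le.1 hy).1]), mul_add,
      Real.exp_add]
    refine mul_le_mul_of_nonneg_left ?_ (Real.exp_pos _).le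
    have h1 : |θ * y| ≤ 1 := by
      rw [abs_mul, abs_of_nonneg hθ]
      exact (mul_le_mul_of_nonneg_left hy hθ).trans hθK
    have h2 := exp_le_quadratic h1 le_rfl
    have h3 : y ^ 2 ≤ K ^ 2 := by rw [← sq_abs y]; exact pow_le_pow_left₀ (abs_nonneg _) hy 2
    have h4 := mul_le_mul_of_nonneg_left h3 (sq_nonneg θ)
    have h5 : θ ^ 2 * K ^ 2 = θ * (δ / 2) := by rw [← hθδ]; ring
    linarith [mul_pow θ y 2]
  have h1 := mul_le_mul_of_nonneg_left (aux _ hab) hp0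
  have h2 := mul_le_mul_of_nonneg_left (aux _ ha) (sub_nonneg.2 hp1)
  have h3 := mul_le_mul_of_nonneg_left (mul_le_mul_of_nonneg_left hd hθ)
    (Real.exp_pos (θ * |x|)).le
  linarith

/-- Below `-K` reflect the positive case; inside `[-K, K]` one step reaches at most `2 * K`. -/
theorem lyapunov_step {p a b x θ K δ : ℝ} (hp0 : 0 ≤ p) (hp1 : p ≤ 1) (hθ : 0 ≤ θ)
    (hθK : θ * K ≤ 1) (hθδ : θ * K ^ 2 = δ / 2) (hρ : 0 ≤ 1 - θ * δ / 2)
    (ha : |a| ≤ K) (hab : |a + b| ≤ K)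
    (hpos : 0 < x → a + b * p ≤ -δ) (hneg : x < 0 → δ ≤ a + b * p) :
    p * Real.exp (θ * |x + (a + b)|) + (1 - p) * Real.exp (θ * |x + a|) ≤
      (1 - θ * δ / 2) * Real.exp (θ * |x|) + Real.exp (θ * (2 * K)) := by
  have hK : 0 ≤ K := (abs_nonneg a).trans ha
  rcases lt_or_ge K x with h | h
  · have := lyapunov_step_of_pos hp0 hp1 hθ hθK hθδ ha hab h (hpos (by linarith))
    linarith [Real.exp_pos (θ * (2 * K))]
  rcases lt_or_ge K (-x) with h' | h'
  · have hn := hneg (by linarith)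
    have := lyapunov_step_of_pos (a := -a) (b := -b) hp0 hp1 hθ hθK hθδ (by rwa [abs_neg])
      (by rwa [← neg_add, abs_neg]) h' (by linarith)
    rw [← neg_add, ← neg_add, ← neg_add, abs_neg, abs_neg, abs_neg] at this
    linarith [Real.exp_pos (θ * (2 * K))]
  · have hx : |x| ≤ K := abs_le.2 ⟨by linarith, h⟩
    have aux : ∀ y : ℝ, |y| ≤ K → Real.exp (θ * |x + y|) ≤ Real.exp (θ * (2 * K)) := by
      intro y hy
      refine Real.exp_le_exp.2 (mul_le_mul_of_nonneg_left ?_ hθ)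
      linarith [abs_add_le x y]
    have h1 := mul_le_mul_of_nonneg_left (aux _ hab) hp0
    have h2 := mul_le_mul_of_nonneg_left (aux _ ha) (sub_nonneg.2 hp1)
    linarith [mul_nonneg hρ (Real.exp_pos (θ * |x|)).le]

section Walk

variable {Ω : Type*} [mΩ : MeasurableSpace Ω] {μ : Measure Ω} {ℱ : Filtration ℕ mΩ}
  {p : Fin 2 → ℝ} {served : ℕ → Ω → Fin 2} {success : ℕ → Set Ω}

/-- A walk with drift towards the origin grows at most logarithmically. -/
theorem IsSystem.exists_ae_eventually_abs_walk_le_log [IsProbabilityMeasure μ]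
    (hsys : IsSystem μ ℱ p served success) (hp : ∀ j, 0 < p j ∧ p j ≤ 1) {a b : Fin 2 → ℝ}
    {K δ : ℝ} (hδ : 0 < δ) (hδK : δ ≤ K) (ha : ∀ j, |a j| ≤ K) (hab : ∀ j, |a j + b j| ≤ K)
    (hpos : ∀ t ω, 0 < walk served success a b t ω →
      a (served t ω) + b (served t ω) * p (served t ω) ≤ -δ)
    (hneg : ∀ t ω, walk served success a b t ω < 0 →
      δ ≤ a (served t ω) + b (served t ω) * p (served t ω)) :
    ∃ C, ∀ᵐ ω ∂μ, ∀ᶠ n : ℕ in atTop,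
      |walk served success a b n ω| ≤ C * Real.log ((n : ℝ) + 1) := by
  have hK : 0 < K := hδ.trans_le hδK
  obtain ⟨θ, hθ⟩ : ∃ θ, θ = δ / (2 * K ^ 2) := ⟨_, rfl⟩
  have hθ0 : 0 < θ := by rw [hθ]; positivity
  have hθδ : θ * K ^ 2 = δ / 2 := by rw [hθ]; field_simp
  have hθK : θ * K ≤ 1 := by
    refine le_of_mul_le_mul_right ?_ hK
    have : θ * K * K = θ * K ^ 2 := by ring
    rw [this, hθδ]; linarith
  have hθδ1 : θ * δ ≤ 1 := (mul_le_mul_of_nonneg_left hδK hθ0.le).trans hθK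
  have hρ : 0 ≤ 1 - θ * δ / 2 := by linarith
  have hρ1 : 0 < θ * δ / 2 := by positivity
  have hcont : Continuous fun x : ℝ => Real.exp (θ * |x|) := by fun_prop
  have hint := fun t => hsys.integrable_comp_walk a b t hcont
  set E := Real.exp (θ * (2 * K))
  have hE : 0 < E := Real.exp_pos _
  -- Preserved by `M ↦ (1 - θ δ / 2) M + E`; the extra `1` covers the initial value `exp 0`.
  set M := 1 + E / (θ * δ / 2) with hM
  have hMpos : 0 < M := by positivity
  have hbound : ∀ t, ∫ ω, Real.exp (θ * |walk served success a b t ω|) ∂μ ≤ M := by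
    intro t
    induction t with
    | zero =>
      have h1 : 1 ≤ M := le_add_of_nonneg_right (by positivity)
      simpa [walk_zero] using h1
    | succ t ih =>
      have h := hsys.setIntegral_walk_succ_le a b t hcont MeasurableSet.univ
        (((hint t).const_mul (1 - θ * δ / 2)).add (integrable_const E)) fun ω _ =>
          lyapunov_step (hp _).1.le (hp _).2 hθ0.le hθK hθδ hρ (ha _) (hab _) (hpos t ω) (hneg t ω)
      simp only [Measure.restrict_univ, Pi.add_apply] at h
      rw [integral_add ((hint t).const_mul _) (integrable_const E), integral_const_mul] at h
      simp only [integral_const, probReal_univ, one_smul] at h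
      refine h.trans ((add_le_add_left (mul_le_mul_of_nonneg_left ih hρ) E).trans ?_)
      have : θ * δ / 2 * M = θ * δ / 2 + E := by rw [hM]; field_simp
      linarith
  have hsum : Summable fun k : ℕ => M * (1 / ((k : ℝ) + 1) ^ 2) := by
    refine Summable.mul_left _ ?_
    have := (summable_nat_add_iff 1).2 (Real.summable_one_div_nat_pow.2 (by norm_num : 1 < 2))
    simpa using this
  -- Markov at level `(k + 1) ^ 2` is summable; taking logarithms gives the constant `2 / θ`.
  have hBC := ae_eventually_notMem_of_le (μ := μ)
    (s := fun k => {ω | ((k : ℝ) + 1) ^ 2 ≤ Real.exp (θ * |walk served success a b k ω|)}) hsum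
    (Eventually.of_forall fun k => by
      have h := mul_meas_ge_le_integral_of_nonneg (ae_of_all _ fun ω => (Real.exp_pos _).le)
        (hint k) (((k : ℝ) + 1) ^ 2)
      rw [← ofReal_measureReal]
      refine ENNReal.ofReal_le_ofReal ?_
      rw [mul_one_div, le_div_iff₀ (by positivity), mul_comm]
      exact h.trans (hbound k))
  refine ⟨2 / θ, ?_⟩
  filter_upwards [hBC] with ω hω
  filter_upwards [hω] with n hn
  have h1 := Real.log_le_log (Real.exp_pos _) (not_le.1 hn).le
  rw [Real.log_exp, Real.log_pow] at h1
  rw [div_mul_eq_mul_div, le_div_iff₀ hθ0]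
  push_cast at h1
  linarith

end Walk

/-! ### Growth of `φ`: above the logarithm, below linear. -/

theorem eventually_one_le_log_log : ∀ᶠ n : ℕ in atTop, 1 ≤ Real.log (Real.log n) :=
  ((Real.tendsto_log_atTop.comp Real.tendsto_log_atTop).comp
    tendsto_natCast_atTop_atTop).eventually_ge_atTop 1

theorem eventually_sqrt_le_phi : ∀ᶠ n : ℕ in atTop, Real.sqrt n ≤ phi n := by
  filter_upwards [eventually_one_le_log_log] with n hn
  refine Real.sqrt_le_sqrt ?_
  have := mul_le_mul_of_nonneg_left hn (by positivity : (0 : ℝ) ≤ 2 * n)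
  have h0 : (0 : ℝ) ≤ n := Nat.cast_nonneg n
  linarith

theorem eventually_phi_pos : ∀ᶠ n : ℕ in atTop, 0 < phi n := by
  filter_upwards [eventually_sqrt_le_phi, eventually_gt_atTop 0] with n hn h0
  exact (Real.sqrt_pos.2 (by exact_mod_cast h0)).trans_le hn

theorem eventually_phi_le_mul {ε : ℝ} (hε : 0 < ε) : ∀ᶠ n : ℕ in atTop, phi n ≤ ε * n := by
  have h := tendsto_natCast_atTop_atTop.eventually
    (Real.isLittleO_log_id_atTop.bound (by positivity : 0 < ε ^ 2 / 2))
  filter_upwards [h, eventually_one_le_log_log, eventually_ge_atTop 1] with n hn hLL h1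
  have hlog : 0 ≤ Real.log n := Real.log_natCast_nonneg n
  have h2 : Real.log (Real.log n) ≤ Real.log n := Real.log_le_self hlog
  rw [Real.norm_eq_abs, abs_of_nonneg hlog, id, Real.norm_natCast] at hn
  refine Real.sqrt_le_iff.2 ⟨by positivity, ?_⟩
  have h3 := mul_le_mul_of_nonneg_left (h2.trans hn) (by positivity : (0 : ℝ) ≤ 2 * n)
  linarith [mul_pow ε (n : ℝ) 2, sq (n : ℝ),
    (by ring : 2 * (n : ℝ) * (ε ^ 2 / 2 * n) = (ε * n) ^ 2)]

theorem eventually_log_le_phi {ε : ℝ} (hε : 0 < ε) :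
    ∀ᶠ n : ℕ in atTop, Real.log ((n : ℝ) + 1) ≤ ε * phi n := by
  have ht : Tendsto (fun n : ℕ => (n : ℝ) + 1) atTop atTop :=
    tendsto_atTop_add_const_right _ _ tendsto_natCast_atTop_atTop
  have h := ht.eventually ((isLittleO_log_rpow_atTop (by norm_num : (0 : ℝ) < 1 / 2)).bound
    (half_pos hε))
  filter_upwards [h, eventually_sqrt_le_phi, eventually_ge_atTop 1] with n hn hs h1
  have h1' : (1 : ℝ) ≤ n := by exact_mod_cast h1
  rw [← Real.sqrt_eq_rpow, Real.norm_eq_abs, Real.norm_eq_abs,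
    abs_of_nonneg (Real.sqrt_nonneg _)] at hn
  have h2 : Real.sqrt ((n : ℝ) + 1) ≤ 2 * Real.sqrt n := by
    refine Real.sqrt_le_iff.2 ⟨by positivity, ?_⟩
    rw [mul_pow, Real.sq_sqrt (by positivity)]
    linarith
  have h3 := mul_le_mul_of_nonneg_left h2 (half_pos hε).le
  have h4 := mul_le_mul_of_nonneg_left hs hε.le
  linarith [le_abs_self (Real.log ((n : ℝ) + 1))]

theorem sqrt_add_le_add_sqrt {x y : ℝ} (hx : 0 ≤ x) (hy : 0 ≤ y) :
    Real.sqrt (x + y) ≤ Real.sqrt x + Real.sqrt y := by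
  refine Real.sqrt_le_iff.2 ⟨by positivity, ?_⟩
  have := mul_nonneg (Real.sqrt_nonneg x) (Real.sqrt_nonneg y)
  linarith [add_sq (Real.sqrt x) (Real.sqrt y), Real.sq_sqrt hx, Real.sq_sqrt hy]

/-! ### Debts and attempt counts as walks. -/

section Debt

variable {Ω : Type*} {p q : Fin 2 → ℝ} {served : ℕ → Ω → Fin 2} {success : ℕ → Set Ω}

theorem debt_eq_walk (j : Fin 2) (t : ℕ) (ω : Ω) :
    debt q served success j t ω =
      walk served success (fun _ => q j) (fun i => if i = j then -1 else 0) t ω := by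
  classical
  rw [debt, deliveries, walk, Finset.sum_add_distrib, Finset.card_filter]
  push_cast
  rw [Finset.sum_const, Finset.card_range, nsmul_eq_mul, sub_eq_add_neg, ← Finset.sum_neg_distrib]
  congr 1
  refine Finset.sum_congr rfl fun s _ => ?_
  by_cases h : served s ω = j <;> by_cases h' : ω ∈ success s <;> simp [h, h']

/-- In this form each increment visibly has conditional mean `1 - p j / p j = 0`, whichever user is
attempted. -/
theorem total_debt_eq_walk (hb : q 0 / p 0 + q 1 / p 1 = 1) (t : ℕ) (ω : Ω) :
    debt q served success 0 t ω / p 0 + debt q served success 1 t ω / p 1 =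
      walk served success (fun _ => 1) (fun j => -(1 / p j)) t ω := by
  have h := walk_linear_combination (served := served) (success := success) (1 / p 0) (1 / p 1)
    (fun _ => q 0) (fun i => if i = 0 then -1 else 0) (fun _ => q 1)
    (fun i => if i = 1 then -1 else 0) t ω
  rw [debt_eq_walk, debt_eq_walk, div_eq_inv_mul, div_eq_inv_mul, ← one_div, ← one_div, ← h]
  congr 1
  · funext j; linear_combination hb
  · funext j; fin_cases j <;> simp

theorem debt_gap_eq_walk (t : ℕ) (ω : Ω) :
    debt q served success 0 t ω / p 0 - debt q served success 1 t ω / p 1 =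
      walk served success (fun _ => q 0 / p 0 - q 1 / p 1)
        (fun j => if j = 0 then -(1 / p 0) else 1 / p 1) t ω := by
  have h := walk_linear_combination (served := served) (success := success) (1 / p 0) (-(1 / p 1))
    (fun _ => q 0) (fun i => if i = 0 then -1 else 0) (fun _ => q 1)
    (fun i => if i = 1 then -1 else 0) t ω
  rw [debt_eq_walk, debt_eq_walk, div_eq_inv_mul, div_eq_inv_mul, ← one_div, ← one_div,
    sub_eq_add_neg, ← neg_mul, ← h]
  congr 1
  · funext j; ring
  · funext j; fin_cases j <;> simp

/-- The number of attempts for user `j`, expressed by the debt and a centred walk. -/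
theorem attempts_eq (j : Fin 2) (t : ℕ) (ω : Ω) :
    p j * walk served success (fun i => if i = j then 1 else 0) 0 t ω =
      walk served success (fun i => if i = j then p j else 0) (fun i => if i = j then -1 else 0) t ω
        + t * q j - debt q served success j t ω := by
  rw [debt_eq_walk]
  simp only [walk, Finset.mul_sum]
  have : (t : ℝ) * q j = ∑ s ∈ Finset.range t, q j := by simp
  rw [this, ← Finset.sum_add_distrib, ← Finset.sum_sub_distrib]
  refine Finset.sum_congr rfl fun s _ => ?_
  by_cases h : served s ω = j
  · simp only [h, if_true, Pi.zero_apply]; ring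
  · simp [h]

theorem walk_eq_sum_attempts (v : Fin 2 → ℝ) (t : ℕ) (ω : Ω) :
    walk served success v 0 t ω =
      v 0 * walk served success (fun i => if i = 0 then 1 else 0) 0 t ω +
      v 1 * walk served success (fun i => if i = 1 then 1 else 0) 0 t ω := by
  rw [← walk_linear_combination]
  congr 1
  · funext j; fin_cases j <;> simp
  · funext j; simp

theorem attempts_le (j : Fin 2) (t : ℕ) (ω : Ω) :
    walk served success (fun i => if i = j then 1 else 0) 0 t ω ≤ t := by
  rw [walk]
  refine (Finset.sum_le_sum (g := fun _ => (1 : ℝ)) fun s _ => ?_).trans (by simp)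
  by_cases h : served s ω = j <;> simp [h]

/-- Recovers a debt from sum and difference. The sign `1` serves the final bound, the sign `-1` the
attempt count. -/
theorem sign_mul_debt_le (hp : ∀ j, 0 < p j) (j : Fin 2) (t : ℕ) (ω : Ω) {s : ℝ} (hs : s = 1 ∨ s = -1) :
    s * debt q served success j t ω ≤ p j *
      (s * (debt q served success 0 t ω / p 0 + debt q served success 1 t ω / p 1) +
        |debt q served success 0 t ω / p 0 - debt q served success 1 t ω / p 1|) / 2 := by
  have h : s * debt q served success j t ω = p j * (s * (debt q served success j t ω / p j)) := by
    have := (hp j).ne'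
    field_simp
  rw [h, mul_div_assoc]
  refine mul_le_mul_of_nonneg_left ?_ (hp j).le
  have h1 := le_abs_self (debt q served success 0 t ω / p 0 - debt q served success 1 t ω / p 1)
  have h2 := neg_abs_le (debt q served success 0 t ω / p 0 - debt q served success 1 t ω / p 1)
  rcases hs with rfl | rfl <;> fin_cases j <;> simp only [Fin.zero_eta, Fin.mk_one] <;> linarith

end Debt

/-! ### The two weighted debts under MWDF. -/

section MWDF

variable {Ω : Type*} [mΩ : MeasurableSpace Ω] {μ : Measure Ω} {ℱ : Filtration ℕ mΩ}
  {p q : Fin 2 → ℝ} {served : ℕ → Ω → Fin 2} {success : ℕ → Set Ω}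

/-- Under MWDF the two weighted debts stay close to each other. -/
theorem IsSystem.ae_eventually_debt_gap_le [IsProbabilityMeasure μ]
    (hsys : IsSystem μ ℱ p served success) (hp : ∀ j, 0 < p j ∧ p j ≤ 1) (hq : ∀ j, 0 < q j)
    (hb : q 0 / p 0 + q 1 / p 1 = 1) (hpol : IsMWDF p q served success) {ε : ℝ} (hε : 0 < ε) :
    ∀ᵐ ω ∂μ, ∀ᶠ n : ℕ in atTop,
      |debt q served success 0 n ω / p 0 - debt q served success 1 n ω / p 1| ≤ ε * phi n := by
  have hp0 := (hp 0).1
  have hp1 := (hp 1).1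
  have hr0 : 0 < q 0 / p 0 := div_pos (hq 0) hp0
  have hr1 : 0 < q 1 / p 1 := div_pos (hq 1) hp1
  have hi0 : 0 < 1 / p 0 := by positivity
  have hi1 : 0 < 1 / p 1 := by positivity
  -- By the boundary condition the drift of the gap is `-2 q 1 / p 1` when user 0 is attempted and
  -- `2 q 0 / p 0` when user 1 is. Ties occur only at gap zero, where no drift is required.
  obtain ⟨C, hC⟩ := hsys.exists_ae_eventually_abs_walk_le_log hp
    (a := fun _ => q 0 / p 0 - q 1 / p 1) (b := fun j => if j = 0 then -(1 / p 0) else 1 / p 1)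
    (K := 2 + 1 / p 0 + 1 / p 1) (δ := 2 * min (q 0 / p 0) (q 1 / p 1))
    (by positivity) (by linarith [min_le_left (q 0 / p 0) (q 1 / p 1)])
    (fun j => abs_le.2 ⟨by linarith, by linarith⟩)
    (fun j => by
      refine abs_le.2 ?_
      fin_cases j <;> simp <;> simp only [one_div] at hi0 hi1 <;> constructor <;> linarith)
    (fun t ω h => by
      rw [← debt_gap_eq_walk] at h
      have hs : served t ω = 0 := by
        by_contra hne
        have h1 : served t ω = 1 := by omega
        have := hpol t ω 0
        rw [h1] at this
        linarith
      rw [hs, if_pos rfl]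
      have : -(1 / p 0) * p 0 = -1 := by field_simp
      linarith [min_le_right (q 0 / p 0) (q 1 / p 1)])
    (fun t ω h => by
      rw [← debt_gap_eq_walk] at h
      have hs : served t ω = 1 := by
        by_contra hne
        have h1 : served t ω = 0 := by omega
        have := hpol t ω 1
        rw [h1] at this
        linarith
      rw [hs, if_neg (by decide)]
      have : 1 / p 1 * p 1 = 1 := by field_simp
      linarith [min_le_left (q 0 / p 0) (q 1 / p 1)])
  filter_upwards [hC] with ω hω
  filter_upwards [hω, eventually_log_le_phi (div_pos hε (by positivity : 0 < |C| + 1)),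
    eventually_phi_pos] with n hn hl hφ
  rw [debt_gap_eq_walk]
  refine hn.trans ?_
  have h0 : 0 ≤ Real.log ((n : ℝ) + 1) :=
    Real.log_nonneg (by have : (0 : ℝ) ≤ n := Nat.cast_nonneg n; linarith)
  calc C * Real.log ((n : ℝ) + 1) ≤ (|C| + 1) * Real.log ((n : ℝ) + 1) :=
        mul_le_mul_of_nonneg_right (by linarith [le_abs_self C]) h0
    _ ≤ (|C| + 1) * (ε / (|C| + 1) * phi n) := mul_le_mul_of_nonneg_left hl (by positivity)
    _ = ε * phi n := by field_simp

/-- A centred walk is asymptotically below every positive linear function. -/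
theorem IsSystem.ae_eventually_walk_le_mul [IsProbabilityMeasure μ]
    (hsys : IsSystem μ ℱ p served success) (hp : ∀ j, 0 < p j ∧ p j ≤ 1) {a b : Fin 2 → ℝ}
    (hab : ∀ j, a j + b j * p j = 0) {ε : ℝ} (hε : 0 < ε) :
    ∀ᵐ ω ∂μ, ∀ᶠ n : ℕ in atTop, walk served success a b n ω ≤ ε * n := by
  let v : Fin 2 → ℝ := fun j => p j * (1 - p j) * b j ^ 2
  have hv : ∀ j, 0 ≤ v j := fun j =>
    mul_nonneg (mul_nonneg (hp j).1.le (sub_nonneg.2 (hp j).2)) (sq_nonneg _)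
  -- A crude variance rate suffices here; the `1` keeps it positive for perfect channels.
  have hB : 0 < v 0 + v 1 + 1 := by linarith [hv 0, hv 1]
  have h := hsys.ae_eventually_walk_le_phi hp hab hB (lt_add_one _) (ae_of_all _ fun ω =>
    Eventually.of_forall fun n => by
      change walk served success v 0 n ω ≤ _
      rw [walk_eq_sum_attempts]
      have h0 := mul_le_mul_of_nonneg_left
        (attempts_le (served := served) (success := success) 0 n ω) (hv 0)
      have h1 := mul_le_mul_of_nonneg_left
        (attempts_le (served := served) (success := success) 1 n ω) (hv 1)
      have : (0 : ℝ) ≤ n := Nat.cast_nonneg n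
      linarith)
  have hs : 0 < Real.sqrt (v 0 + v 1 + 1 + 1) := Real.sqrt_pos.2 (by linarith)
  filter_upwards [h] with ω hω
  filter_upwards [hω, eventually_phi_le_mul (div_pos hε hs)] with n hn hφ
  refine hn.trans ((mul_le_mul_of_nonneg_left hφ hs.le).trans (le_of_eq ?_))
  field_simp

/-- Under MWDF, user `j` is attempted in at most the fraction `q j / p j` of the frames. -/
theorem IsSystem.ae_eventually_attempts_le [IsProbabilityMeasure μ]
    (hsys : IsSystem μ ℱ p served success) (hp : ∀ j, 0 < p j ∧ p j ≤ 1) (hq : ∀ j, 0 < q j)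
    (hb : q 0 / p 0 + q 1 / p 1 = 1) (hpol : IsMWDF p q served success) (j : Fin 2)
    {ε : ℝ} (hε : 0 < ε) :
    ∀ᵐ ω ∂μ, ∀ᶠ n : ℕ in atTop,
      walk served success (fun i => if i = j then 1 else 0) 0 n ω ≤ (q j / p j + ε) * n := by
  have hpj := (hp j).1
  have h1 := hsys.ae_eventually_walk_le_mul hp (a := fun i => if i = j then p j else 0)
    (b := fun i => if i = j then -1 else 0)
    (fun i => by by_cases h : i = j <;> simp [h]) (by positivity : 0 < p j * ε / 2)
  -- The negated total debt is centred too; this bounds the debts from below, hence the attempts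
  -- from above.
  have h2 := hsys.ae_eventually_walk_le_mul hp (a := fun _ => -1) (b := fun i => 1 / p i)
    (fun i => by have := (hp i).1.ne'; field_simp; ring) (half_pos hε)
  have h3 := hsys.ae_eventually_debt_gap_le hp hq hb hpol one_pos
  filter_upwards [h1, h2, h3] with ω h1 h2 h3
  filter_upwards [h1, h2, h3, eventually_phi_le_mul (half_pos hε)] with n h1 h2 h3 h4
  have h5 := sign_mul_debt_le (q := q) (served := served) (success := success)
    (fun j => (hp j).1) j n ω (Or.inr rfl : (-1 : ℝ) = 1 ∨ (-1 : ℝ) = -1)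
  rw [total_debt_eq_walk hb] at h5
  have h6 : walk served success (fun _ => -1) (fun i => 1 / p i) n ω =
      -1 * walk served success (fun _ => 1) (fun j => -(1 / p j)) n ω := by
    have := walk_linear_combination (served := served) (success := success) (-1) 0 (fun _ => 1)
      (fun j => -(1 / p j)) 0 0 n ω
    simpa using this
  rw [h6] at h2
  have h7 : -1 * debt q served success j n ω ≤ p j * (ε / 2 * n + ε / 2 * n) / 2 := by
    refine h5.trans ?_
    rw [mul_div_assoc, mul_div_assoc]
    refine mul_le_mul_of_nonneg_left ?_ hpj.le
    linarith
  refine le_of_mul_le_mul_left ?_ hpj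
  rw [attempts_eq (q := q)]
  have h8 : p j * ((q j / p j + ε) * n) = q j * n + p j * ε * n := by field_simp
  rw [h8]
  linarith

theorem c_nonneg (hp : ∀ j, 0 < p j ∧ p j ≤ 1) (hq : ∀ j, 0 < q j) (j : Fin 2) : 0 ≤ c p q j :=
  div_nonneg (mul_nonneg (hq j).le (sub_nonneg.2 (hp j).2)) (sq_nonneg _)

/-- The upper half of the law of the iterated logarithm for the total weighted debt. -/
theorem IsSystem.ae_eventually_total_debt_le [IsProbabilityMeasure μ]
    (hsys : IsSystem μ ℱ p served success) (hp : ∀ j, 0 < p j ∧ p j ≤ 1) (hq : ∀ j, 0 < q j)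
    (hb : q 0 / p 0 + q 1 / p 1 = 1) (hpol : IsMWDF p q served success) {ε : ℝ} (hε : 0 < ε) :
    ∀ᵐ ω ∂μ, ∀ᶠ n : ℕ in atTop,
      debt q served success 0 n ω / p 0 + debt q served success 1 n ω / p 1 ≤
        Real.sqrt (c p q 0 + c p q 1 + ε) * phi n := by
  let v : Fin 2 → ℝ := fun j => p j * (1 - p j) * (-(1 / p j)) ^ 2
  have hv : ∀ j, 0 ≤ v j := fun j =>
    mul_nonneg (mul_nonneg (hp j).1.le (sub_nonneg.2 (hp j).2)) (sq_nonneg _)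
  -- Variance per attempt times the share of attempts.
  have hvc : ∀ j, v j * (q j / p j) = c p q j := fun j => by
    have := (hp j).1.ne'
    simp only [v, c]
    field_simp
  have hc0 := c_nonneg hp hq 0
  have hc1 := c_nonneg hp hq 1
  set w := v 0 + v 1 + 1 with hw
  have hwpos : 0 < w := by linarith [hv 0, hv 1]
  have hN := fun j => hsys.ae_eventually_attempts_le hp hq hb hpol j
    (by positivity : 0 < ε / 2 / w)
  have hV : ∀ᵐ ω ∂μ, ∀ᶠ n : ℕ in atTop,
      walk served success v 0 n ω ≤ (c p q 0 + c p q 1 + ε / 2) * n := by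
    filter_upwards [hN 0, hN 1] with ω h0 h1
    filter_upwards [h0, h1] with n h0 h1
    rw [walk_eq_sum_attempts]
    have h0' := mul_le_mul_of_nonneg_left h0 (hv 0)
    have h1' := mul_le_mul_of_nonneg_left h1 (hv 1)
    have hn : (0 : ℝ) ≤ ε / 2 / w * n := by positivity
    have e : ε / 2 * n = w * (ε / 2 / w * n) := by field_simp
    have e2 : v 0 * ((q 0 / p 0 + ε / 2 / w) * n) + v 1 * ((q 1 / p 1 + ε / 2 / w) * n) =
        (c p q 0 + c p q 1) * n + (v 0 + v 1) * (ε / 2 / w * n) := by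
      rw [← hvc 0, ← hvc 1]; ring
    rw [add_mul, e]
    linarith
  -- The `ε / 2` keeps the rate positive even if both `c` vanish; the other half gives the strict
  -- gap.
  have h := hsys.ae_eventually_walk_le_phi hp (a := fun _ => 1) (b := fun j => -(1 / p j))
    (fun j => by have := (hp j).1.ne'; field_simp; ring)
    (by positivity : 0 < c p q 0 + c p q 1 + ε / 2)
    (by linarith : c p q 0 + c p q 1 + ε / 2 < c p q 0 + c p q 1 + ε) hV
  filter_upwards [h] with ω hω
  filter_upwards [hω] with n hn
  rwa [total_debt_eq_walk hb]

end MWDF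

end RealTimeScheduling

open RealTimeScheduling in
theorem mainTheorem2 {Ω : Type*} [mΩ : MeasurableSpace Ω] (μ : Measure Ω) [IsProbabilityMeasure μ]
    (ℱ : Filtration ℕ mΩ) (p q : Fin 2 → ℝ)
    (hp : ∀ j, 0 < p j ∧ p j ≤ 1) (hq : ∀ j, 0 < q j)
    (hboundary : q 0 / p 0 + q 1 / p 1 = 1)
    (served : ℕ → Ω → Fin 2) (success : ℕ → Set Ω)
    (hsys : IsSystem μ ℱ p served success)
    (hpol : IsMWDF p q served success) :
    ∀ᵐ ω ∂μ, ∀ j : Fin 2,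
      limsup (fun t : ℕ => ((debt q served success j t ω / phi t : ℝ) : EReal)) atTop ≤
        ((p j * ((Real.sqrt (c p q 0) + Real.sqrt (c p q 1)) / 2) : ℝ) : EReal) := by
  -- A countable family of `ε` leaves a single null set.
  have hε : ∀ m : ℕ, 0 < 1 / ((m : ℝ) + 1) := fun m => by positivity
  have hS := ae_all_iff.2 fun m =>
    hsys.ae_eventually_total_debt_le hp hq hboundary hpol (hε m)
  have hD := ae_all_iff.2 fun m =>
    hsys.ae_eventually_debt_gap_le hp hq hboundary hpol (hε m)
  filter_upwards [hS, hD] with ω hS hD j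
  refine EReal.le_of_forall_lt_iff_le.1 fun z hz => ?_
  have hz' : p j * ((Real.sqrt (c p q 0) + Real.sqrt (c p q 1)) / 2) < z := by exact_mod_cast hz
  have hpj := (hp j).1
  have hlim : Tendsto (fun m : ℕ => p j * (Real.sqrt (c p q 0 + c p q 1 + 1 / ((m : ℝ) + 1)) +
      1 / ((m : ℝ) + 1)) / 2) atTop (nhds (p j * (Real.sqrt (c p q 0 + c p q 1 + 0) + 0) / 2)) :=
    have ht := tendsto_one_div_add_atTop_nhds_zero_nat (𝕜 := ℝ)
    ((((ht.const_add _).sqrt).add ht).const_mul _).div_const _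
  have hlt : p j * (Real.sqrt (c p q 0 + c p q 1 + 0) + 0) / 2 < z := by
    refine lt_of_le_of_lt ?_ hz'
    rw [add_zero, add_zero, mul_div_assoc]
    -- Up to here the constant is the sharper `p j * √(c_0 + c_1) / 2`.
    have := sqrt_add_le_add_sqrt (c_nonneg hp hq 0) (c_nonneg hp hq 1)
    gcongr
  obtain ⟨m, hm⟩ := (hlim.eventually (eventually_lt_nhds hlt)).exists
  refine limsup_le_of_le (by isBoundedDefault) ?_
  filter_upwards [hS m, hD m, eventually_phi_pos] with n h1 h2 hφ
  refine EReal.coe_le_coe_iff.2 ?_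
  rw [div_le_iff₀ hφ]
  have h3 := sign_mul_debt_le (q := q) (served := served) (success := success)
    (fun j => (hp j).1) j n ω (Or.inl rfl : (1 : ℝ) = 1 ∨ (1 : ℝ) = -1)
  rw [one_mul, one_mul] at h3
  refine h3.trans (le_trans ?_ (mul_le_mul_of_nonneg_right hm.le hφ.le))
  have h4 := mul_le_mul_of_nonneg_left (add_le_add h1 h2) hpj.le
  linarith
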